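/- Let $\Gamma\subset\mathrm{SL}_2(\mathbb{R})$ be a discrete subgroup such that $\Gamma\backslash\mathbb{H}$ is compact and such that $\Gamma$ contains no elliptic elements (no $\gamma$ with $|\mathrm{tr}\,\gamma|<2$). Let $\mathcal{F}_\Gamma\subset\mathbb{H}$ be a closed, connected fundamental domain for $\Gamma$ (its translates cover $\mathbb{H}$, every $\gamma\in\Gamma\setminus\{\pm 1\}$ moves its interior off itself, and its boundary has measure zero), let $\mu_{\mathrm{hyp}}=\eta^{-2}\,d\xi\,d\eta$ ($\tau=\xi+i\eta$), and let $$r_\Gamma=\inf\{\mathrm{dist}_{\mathrm{hyp}}(\tau,\gamma\tau)\mid \tau\in\mathcal{F}_\Gamma,\ \gamma\in\Gamma,\ \gamma\neq\pm 1\}$$ be the injectivity radius. Let $k\ge 5$ be a real number and let $\chi\colon\Gamma\to\{z\in\mathbb{C}:|z|=1\}$ be any map (for instance a unitary character or, for non-integral $k$, a unitary multiplier system of weight $k$). Let $S_{k,\chi}(\Gamma)$ be the space of cusp forms of weight $k$ and character $\chi$, i.e. of holomorphic functions $f\colon\mathbb{H}\to\mathbb{C}$ with $$f(\gamma\tau)(c\tau+d)^{-k}=\chi(\gamma)f(\tau)\qquad\Big(\gamma=\begin{pmatrix}a&b\\c&d\end{pmatrix}\in\Gamma,\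 \tau\in\mathbb{H}\Big)$$ (principal branch of the power) which vanish at all cusps of $\Gamma$ (there are none in the present situation). Let $f_1,\dots,f_{d_k}$, $d_k=\dim S_{k,\chi}(\Gamma)$, be any orthonormal basis of $S_{k,\chi}(\Gamma)$ with respect to the Petersson inner product $\langle f,g\rangle=\int_{\mathcal{F}_\Gamma}f(\tau)\overline{g(\tau)}\,\eta^k\,\mu_{\mathrm{hyp}}(\tau)$, let $B_{k,\chi}(\tau,\tau')=\sum_{j=1}^{d_k}f_j(\tau)\overline{f_j(\tau')}$ be the Bergman kernel, and put $\Vert B_{k,\chi}(\tau,\tau')\Vert_{\mathrm{Pet}}=|B_{k,\chi}(\tau,\tau')|\,(\mathrm{Im}\,\tau\,\mathrm{Im}\,\tau')^{k/2}$. Then for every $\tau\in\mathbb{H}$ $$\Vert B_{k,\chi}(\tau,\tau)\Vert_{\mathrm{Pet}}\le\frac{k-1}{2\pi}+\frac{3(k-1)}{\pi\cosh^{k-4}(r_\Gamma/4)}\Big(1+\frac{1}{\sinh^2(r_\Gamma/4)}\Big).$$ -/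

import Mathlib

open scoped MatrixGroups UpperHalfPlane Manifold Pointwise ComplexConjugate

noncomputable section

namespace BergmanKernel

/-- A Fuchsian subgroup of `SL(2, ℝ)`: a discrete subgroup. -/
def IsFuchsian (Γ : Subgroup SL(2, ℝ)) : Prop := DiscreteTopology Γ

/-- `Γ` is cocompact: the quotient space `Γ \ ℍ` (with the quotient topology) is compact. -/
def IsCocompact (Γ : Subgroup SL(2, ℝ)) : Prop :=
  CompactSpace (Quotient (MulAction.orbitRel Γ ℍ))

/-- `Γ` contains no elliptic elements, i.e. no elements `γ` with `|tr γ| < 2`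
(so `-1` is not elliptic). -/
def HasNoElliptic (Γ : Subgroup SL(2, ℝ)) : Prop :=
  ∀ γ ∈ Γ, 2 ≤ |(γ : Matrix (Fin 2) (Fin 2) ℝ).trace|

/-- `F` is a (closed, connected) fundamental domain for the action of `Γ` on `ℍ`: its translates
cover `ℍ`, elements of `Γ` other than `± 1` (the ones that act trivially) move its interior off
itself, and its boundary is a null set. -/
structure IsFundDomain (Γ : Subgroup SL(2, ℝ)) (F : Set ℍ) : Prop where
  isClosed : IsClosed F
  isConnected : IsConnected F
  covers : ∀ τ : ℍ, ∃ γ ∈ Γ, γ • τ ∈ F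
  disjoint_interior : ∀ γ ∈ Γ, γ ≠ 1 → γ ≠ -1 → Disjoint (interior F) (γ • interior F)
  null_frontier : MeasureTheory.volume (frontier F) = 0

/-- The injectivity radius `r_Γ`, computed on the fundamental domain `F`: the infimum of the
hyperbolic displacements `dist(τ, γτ)`, where `τ ∈ F` and `γ ∈ Γ`, `γ ≠ ± 1`.
(This is the form that the definition takes if `Γ` has neither cusps nor elliptic points.) -/
def injRadius (Γ : Subgroup SL(2, ℝ)) (F : Set ℍ) : ℝ :=
  sInf {r : ℝ | ∃ τ ∈ F, ∃ γ ∈ Γ, γ ≠ 1 ∧ γ ≠ -1 ∧ r = dist τ (γ • τ)}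

/-- The function `(f|σ)(τ) = f(στ) (cτ + d)^(-k)`, for the principal branch of the power. -/
def slash (k : ℝ) (f : ℍ → ℂ) (σ : SL(2, ℝ)) (τ : ℍ) : ℂ :=
  f (σ • τ) * (UpperHalfPlane.denom σ τ) ^ (-(k : ℂ))

/-- The space `S_{k,χ}(Γ)` of cusp forms of real weight `k` and character `χ` for `Γ`: holomorphic
functions on `ℍ` with `f(γτ) (cτ + d)^(-k) = χ(γ) f(τ)` for `γ ∈ Γ`, that vanish at every cusp
`σ(i∞)` of `Γ`. -/
def cuspForms (Γ : Subgroup SL(2, ℝ)) (k : ℝ) (χ : Γ → Circle) : Submodule ℂ (ℍ → ℂ) where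
  carrier := {f | MDifferentiable 𝓘(ℂ) 𝓘(ℂ) f ∧
    (∀ (γ : Γ) (τ : ℍ), slash k f γ τ = χ γ * f τ) ∧
    ∀ σ : SL(2, ℝ), IsCusp ((σ : GL (Fin 2) ℝ) • OnePoint.infty)
        (Γ.map Matrix.SpecialLinearGroup.toGL) →
      UpperHalfPlane.IsZeroAtImInfty (slash k f σ)}
  zero_mem' := by
    refine ⟨mdifferentiable_const, fun γ τ => by simp [slash], fun σ _ => ?_⟩
    have h : slash k 0 σ = 0 := by
      ext τ
      simp [slash]
    rw [h]
    exact (UpperHalfPlane.zeroAtImInftySubmodule ℂ).zero_mem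
  add_mem' := by
    rintro f g ⟨hf, hf', hf''⟩ ⟨hg, hg', hg''⟩
    have h : ∀ σ, slash k (f + g) σ = slash k f σ + slash k g σ := fun σ => by
      ext τ
      simp [slash, add_mul]
    refine ⟨hf.add hg, fun γ τ => ?_, fun σ hσ => ?_⟩
    · rw [h, Pi.add_apply, hf', hg', Pi.add_apply, mul_add]
    · rw [h]
      exact (UpperHalfPlane.zeroAtImInftySubmodule ℂ).add_mem (hf'' σ hσ) (hg'' σ hσ)
  smul_mem' := by
    rintro c f ⟨hf, hf', hf''⟩
    have h : ∀ σ, slash k (c • f) σ = c • slash k f σ := fun σ => by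
      ext τ
      simp [slash, mul_assoc]
    refine ⟨hf.const_smul c, fun γ τ => ?_, fun σ hσ => ?_⟩
    · rw [h, Pi.smul_apply, hf', Pi.smul_apply, smul_eq_mul, smul_eq_mul]
      ring
    · rw [h]
      exact (UpperHalfPlane.zeroAtImInftySubmodule ℂ).smul_mem c (hf'' σ hσ)

/-- The Petersson inner product `∫_F f₁ conj(f₂) η^k dμ_hyp`, where `η = Im τ`; the volume on `ℍ`
is the hyperbolic measure `dξ dη / η²`. -/
def petersson (F : Set ℍ) (k : ℝ) (f₁ f₂ : ℍ → ℂ) : ℂ :=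
  ∫ τ in F, f₁ τ * conj (f₂ τ) * ((τ.im ^ k : ℝ) : ℂ)

/-- The basis `b` of `S_{k,χ}(Γ)` is orthonormal with respect to the Petersson inner product. -/
def IsOrthonormalBasis {Γ : Subgroup SL(2, ℝ)} {k : ℝ} {χ : Γ → Circle} (F : Set ℍ) {d : ℕ}
    (b : Module.Basis (Fin d) ℂ (cuspForms Γ k χ)) : Prop :=
  ∀ i j, petersson F k (b i : ℍ → ℂ) (b j : ℍ → ℂ) = if i = j then 1 else 0

/-- The Bergman kernel `B(τ, τ') = ∑ⱼ fⱼ(τ) conj(fⱼ(τ'))`, written with the basis `(fⱼ) = b` of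
`S_{k,χ}(Γ)`. -/
def bergmanKernel {Γ : Subgroup SL(2, ℝ)} {k : ℝ} {χ : Γ → Circle} {d : ℕ}
    (b : Module.Basis (Fin d) ℂ (cuspForms Γ k χ)) (τ τ' : ℍ) : ℂ :=
  ∑ j, (b j : ℍ → ℂ) τ * conj ((b j : ℍ → ℂ) τ')

/-- The pointwise Petersson norm `|B(τ, τ')| (Im τ · Im τ')^(k/2)`. -/
def petNorm (k : ℝ) (B : ℍ → ℍ → ℂ) (τ τ' : ℍ) : ℝ :=
  ‖B τ τ'‖ * (τ.im * τ'.im) ^ (k / 2)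

end BergmanKernel

end

section

open MeasureTheory Set Filter Topology

namespace BergmanKernel

/-! Let `r` be the injectivity radius and `y = Im τ`. The proof compares values of cusp forms with
their Petersson norms by a sub-mean-value inequality; no series over `Γ` is estimated. On the
hyperbolic disc of radius `r / 2` about `τ`, Cayley coordinates turn a form `f` into a holomorphic
`g` on a Euclidean disc of radius `tanh (r / 4)`. Averaging `g²` over circles bounds `C ‖f τ‖² y^k`,
with `C = 4π / (k - 1) * (1 - cosh (r / 4) ^ (-2 (k - 1)))`, by the integral of `‖f‖² η^k` over the
disc (`petersson_le_lintegral_ball`). The disc embeds in `Γ \ ℍ`, so that integral is at most the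
one over `F` (`lintegral_ball_le_lintegral_fundDomain`). For `f = B(·, τ)` both `f τ` and the
squared Petersson norm equal `B(τ, τ)`, whence `C * B(τ, τ) y^k ≤ 1`
(`mul_petNorm_bergmanKernel_le_one`). As `r > 0`, this has leading term `(k - 1) / (4π)`, half of
the one claimed, and the rest is elementary. -/

/-! ### Displacements and positivity of the injectivity radius. -/

theorem eq_one_or_neg_one_of_smul_eq_self {γ : SL(2, ℝ)}
    (htr : 2 ≤ |(γ : Matrix (Fin 2) (Fin 2) ℝ).trace|) {τ : ℍ} (h : γ • τ = τ) :
    γ = 1 ∨ γ = -1 := by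
  have hdet := γ.det_coe
  have hfix := congrArg UpperHalfPlane.coe h
  rw [UpperHalfPlane.coe_specialLinearGroup_apply] at hfix
  replace hfix : (γ 0 0 : ℂ) * τ + γ 0 1 = τ * (γ 1 0 * τ + γ 1 1) :=
    (div_eq_iff (UpperHalfPlane.denom_ne_zero γ τ)).1 hfix
  have hre := congrArg Complex.re hfix
  have him := congrArg Complex.im hfix
  have hτ : 0 < τ.im := τ.im_pos
  rw [Matrix.det_fin_two] at hdet
  rw [Matrix.trace_fin_two] at htr
  simp only [Complex.add_re, Complex.mul_re,
    Complex.add_im, Complex.mul_im, Complex.ofReal_re, Complex.ofReal_im, zero_mul, sub_zero,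
    add_zero, UpperHalfPlane.coe_re, UpperHalfPlane.coe_im] at hre him
  have hsq : 4 ≤ (γ 0 0 + γ 1 1) ^ 2 := by
    rw [← sq_abs]
    nlinarith
  have h1 : γ 0 0 = 2 * γ 1 0 * τ.re + γ 1 1 := by
    apply mul_right_cancel₀ hτ.ne'
    linarith
  have h2 : γ 0 1 = -γ 1 0 * (τ.re ^ 2 + τ.im ^ 2) := by
    rw [h1] at hre
    linarith
  -- With `h1` and `h2` the determinant condition reads `(c x + d)² + c² y² = 1`, so `tr² = 4 - 4 c²
  -- y²`; the trace bound forces `c = 0`.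
  have hc : γ 1 0 = 0 := by
    rw [h2, h1] at hdet
    rw [h1] at hsq
    have : (γ 1 0 * τ.im) ^ 2 ≤ 0 := by nlinarith
    have := pow_eq_zero_iff (two_ne_zero) |>.1 (le_antisymm this (sq_nonneg _))
    exact (mul_eq_zero.1 this).resolve_right hτ.ne'
  rw [hc] at h1 h2
  simp only [mul_zero, zero_mul, zero_add, neg_zero] at h1 h2
  rw [h1, h2] at hdet
  have : (γ 1 1 - 1) * (γ 1 1 + 1) = 0 := by linarith
  rcases mul_eq_zero.1 this with h3 | h3
  · left
    ext i j
    fin_cases i <;> fin_cases j <;> simp [hc, h1, h2] <;> linarith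
  · right
    ext i j
    fin_cases i <;> fin_cases j <;> simp [hc, h1, h2] <;> linarith

theorem neg_one_smul_upperHalfPlane (τ : ℍ) : (-1 : SL(2, ℝ)) • τ = τ := by
  ext
  simp [UpperHalfPlane.coe_specialLinearGroup_apply]

/-- Otherwise `Γ` acts trivially and the quotient is the noncompact `ℍ`. This keeps the infimum in
`injRadius` from being over the empty set, where `sInf` takes the value `0`. -/
theorem exists_mem_ne_one_ne_neg_one {Γ : Subgroup SL(2, ℝ)} (hcc : IsCocompact Γ) :
    ∃ γ ∈ Γ, γ ≠ 1 ∧ γ ≠ -1 := by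
  by_contra! H
  have hinj : Function.Injective (Quotient.mk (MulAction.orbitRel Γ ℍ)) := by
    intro x y hxy
    obtain ⟨⟨γ, hγ⟩, h⟩ := MulAction.orbitRel_apply.1 (Quotient.exact hxy)
    change γ • y = x at h
    by_cases h1 : γ = 1
    · rw [← h, h1, one_smul]
    · rw [← h, H γ hγ h1, neg_one_smul_upperHalfPlane]
  have hopen : IsOpenQuotientMap (Quotient.mk (MulAction.orbitRel Γ ℍ)) :=
    MulAction.isOpenQuotientMap_quotientMk
  have e : ℍ ≃ₜ Quotient (MulAction.orbitRel Γ ℍ) :=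
    (Equiv.ofBijective _ ⟨hinj, hopen.surjective⟩).toHomeomorphOfContinuousOpen
      hopen.continuous hopen.isOpenMap
  have : CompactSpace (Quotient (MulAction.orbitRel Γ ℍ)) := hcc
  have : CompactSpace ℍ := e.symm.compactSpace
  exact not_compactSpace_iff.2 inferInstance this

theorem exists_isCompact_forall_exists_smul_mem {Γ : Subgroup SL(2, ℝ)} (hcc : IsCocompact Γ) :
    ∃ K : Set ℍ, IsCompact K ∧ ∀ τ : ℍ, ∃ γ ∈ Γ, γ • τ ∈ K := by
  have hopen : IsOpenQuotientMap (Quotient.mk (MulAction.orbitRel Γ ℍ)) :=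
    MulAction.isOpenQuotientMap_quotientMk
  have hc : CompactSpace (Quotient (MulAction.orbitRel Γ ℍ)) := hcc
  obtain ⟨N, hN⟩ := isCompact_univ.elim_directed_cover
    (fun n : ℕ => Quotient.mk (MulAction.orbitRel Γ ℍ) '' Metric.ball UpperHalfPlane.I n)
    (fun n => hopen.isOpenMap _ Metric.isOpen_ball)
    (fun q _ => by
      obtain ⟨x, rfl⟩ := hopen.surjective q
      obtain ⟨n, hn⟩ := exists_nat_gt (dist x UpperHalfPlane.I)
      exact mem_iUnion.2 ⟨n, x, hn, rfl⟩)
    (Monotone.directed_le fun m n hmn => image_mono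
      (Metric.ball_subset_ball (Nat.cast_le.2 hmn)))
  refine ⟨Metric.closedBall UpperHalfPlane.I N, isCompact_closedBall _ _, fun τ => ?_⟩
  obtain ⟨x, hx, hxτ⟩ := hN (mem_univ (Quotient.mk (MulAction.orbitRel Γ ℍ) τ))
  obtain ⟨⟨γ, hγ⟩, h⟩ := MulAction.orbitRel_apply.1 (Quotient.exact hxτ)
  change γ • τ = x at h
  exact ⟨γ, hγ, h ▸ Metric.ball_subset_closedBall hx⟩

theorem dist_smul_conj (σ γ : SL(2, ℝ)) (τ : ℍ) :
    dist (σ • τ) ((σ * γ * σ⁻¹) • σ • τ) = dist τ (γ • τ) := by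
  rw [smul_smul, inv_mul_cancel_right, mul_smul, dist_smul]

theorem conj_ne_one_ne_neg_one (σ : SL(2, ℝ)) {γ : SL(2, ℝ)} (h1 : γ ≠ 1) (h2 : γ ≠ -1) :
    σ * γ * σ⁻¹ ≠ 1 ∧ σ * γ * σ⁻¹ ≠ -1 := by
  constructor
  · simpa [mul_inv_eq_one] using h1
  · intro h
    apply h2
    rw [mul_inv_eq_iff_eq_mul, neg_one_mul, ← mul_neg_one] at h
    exact mul_left_cancel h

/-- A cocompact Fuchsian group without elliptic elements displaces all points by at least some
fixed positive distance. -/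
theorem exists_pos_le_dist_smul {Γ : Subgroup SL(2, ℝ)} (hΓ : IsFuchsian Γ)
    (hcc : IsCocompact Γ) (hell : HasNoElliptic Γ) :
    ∃ ε > 0, ∀ τ : ℍ, ∀ γ ∈ Γ, γ ≠ 1 → γ ≠ -1 → ε ≤ dist τ (γ • τ) := by
  obtain ⟨K, hK, hcov⟩ := exists_isCompact_forall_exists_smul_mem hcc
  have : DiscreteTopology Γ := hΓ
  -- Only finitely many `γ` carry a point of `K` to within distance `1` of `K`; all others displace
  -- points of `K` by more than `1`.
  have hfin := ProperlyDiscontinuousSMul.finite_disjoint_inter_image (Γ := Γ) hK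
    (hK.cthickening (r := 1))
  have key : ∀ γ : Γ, ∀ᶠ ε in 𝓝[>] (0 : ℝ), (γ : SL(2, ℝ)) ≠ 1 → (γ : SL(2, ℝ)) ≠ -1 →
      ∀ τ ∈ K, ε ≤ dist τ (γ • τ) := by
    intro γ
    by_cases hγ : (γ : SL(2, ℝ)) = 1 ∨ (γ : SL(2, ℝ)) = -1
    · exact Eventually.of_forall fun ε h1 h2 => (hγ.elim h1 h2).elim
    rcases K.eq_empty_or_nonempty with rfl | hne
    · simp
    obtain ⟨x, -, hx⟩ := hK.exists_isMinOn hne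
      (f := fun τ : ℍ => dist τ (γ • τ)) (by fun_prop)
    have hpos : 0 < dist x (γ • x) := dist_pos.2 fun h =>
      hγ (eq_one_or_neg_one_of_smul_eq_self (hell γ γ.2) h.symm)
    filter_upwards [Ioo_mem_nhdsGT hpos] with ε hε _ _ τ hτ
    exact hε.2.le.trans (hx hτ)
  obtain ⟨ε, hε, hε0, hε1⟩ := (((eventually_all_finite hfin).2 fun γ _ => key γ).and
    (Ioo_mem_nhdsGT (zero_lt_one (α := ℝ)))).exists
  refine ⟨ε, hε0, fun τ γ hγ h1 h2 => ?_⟩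
  obtain ⟨σ, hσ, hστ⟩ := hcov τ
  obtain ⟨h1', h2'⟩ := conj_ne_one_ne_neg_one σ h1 h2
  rw [← dist_smul_conj σ γ τ]
  have hmem : σ * γ * σ⁻¹ ∈ Γ := Γ.mul_mem (Γ.mul_mem hσ hγ) (Γ.inv_mem hσ)
  by_contra! hlt
  refine hlt.not_ge (hε ⟨_, hmem⟩ ⟨(σ * γ * σ⁻¹) • σ • τ, ⟨σ • τ, hστ, rfl⟩, ?_⟩ h1' h2' _ hστ)
  exact Metric.mem_cthickening_of_dist_le _ _ _ _ hστ (by rw [dist_comm]; exact (hlt.trans hε1).le)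

/-- Conjugation by an element of `Γ` that carries `τ` into `F` preserves the displacement, so the
infimum over `F` is one over `ℍ`. -/
theorem injRadius_le_dist_smul {Γ : Subgroup SL(2, ℝ)} {F : Set ℍ}
    (hF : ∀ τ : ℍ, ∃ γ ∈ Γ, γ • τ ∈ F) (τ : ℍ) {γ : SL(2, ℝ)} (hγ : γ ∈ Γ)
    (h1 : γ ≠ 1) (h2 : γ ≠ -1) : injRadius Γ F ≤ dist τ (γ • τ) := by
  obtain ⟨σ, hσ, hστ⟩ := hF τ
  obtain ⟨h1', h2'⟩ := conj_ne_one_ne_neg_one σ h1 h2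
  rw [← dist_smul_conj σ γ τ]
  refine csInf_le ⟨0, ?_⟩ ⟨_, hστ, _, Γ.mul_mem (Γ.mul_mem hσ hγ) (Γ.inv_mem hσ), h1', h2', rfl⟩
  rintro _ ⟨_, -, _, -, -, -, rfl⟩
  exact dist_nonneg

theorem injRadius_pos {Γ : Subgroup SL(2, ℝ)} (hΓ : IsFuchsian Γ)
    (hcc : IsCocompact Γ) (hell : HasNoElliptic Γ) {F : Set ℍ} (hF : F.Nonempty) :
    0 < injRadius Γ F := by
  obtain ⟨ε, hε, h⟩ := exists_pos_le_dist_smul hΓ hcc hell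
  obtain ⟨γ, hγ, h1, h2⟩ := exists_mem_ne_one_ne_neg_one hcc
  obtain ⟨τ, hτ⟩ := hF
  refine hε.trans_le (le_csInf ⟨_, τ, hτ, γ, hγ, h1, h2, rfl⟩ ?_)
  rintro _ ⟨τ, -, γ, hγ, h1, h2, rfl⟩
  exact h τ γ hγ h1 h2

/-! ### The weighted sub-mean-value inequality on the unit disc. -/

/-- The mean value property of the holomorphic function `g ^ 2`, followed by the triangle
inequality. The interval is the angular range of polar coordinates. -/
theorem two_pi_mul_enorm_sq_le_lintegral_circle {g : ℂ → ℂ} {t : ℝ} (ht : 0 < t)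
    (hg : DifferentiableOn ℂ g (Metric.closedBall 0 t)) :
    ENNReal.ofReal (2 * Real.pi) * ‖g 0‖ₑ ^ 2 ≤
      ∫⁻ θ in Ioo (-Real.pi) Real.pi, ‖g (circleMap 0 t θ)‖ₑ ^ 2 := by
  have hd : DiffContOnCl ℂ (fun z => g z ^ 2) (Metric.ball 0 |t|) := by
    rw [abs_of_pos ht]
    refine DifferentiableOn.diffContOnCl ?_
    rw [closure_ball _ ht.ne']
    exact hg.pow 2
  have h := hd.circleAverage
  rw [Real.circleAverage_eq_integral_add (-Real.pi),
    intervalIntegral.integral_comp_add_right (fun θ => g (circleMap 0 t θ) ^ 2),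
    inv_smul_eq_iff₀ (by positivity), zero_add,
    show 2 * Real.pi + -Real.pi = Real.pi by ring,
    intervalIntegral.integral_of_le (by linarith [Real.pi_pos]), integral_Ioc_eq_integral_Ioo] at h
  calc ENNReal.ofReal (2 * Real.pi) * ‖g 0‖ₑ ^ 2 = ‖(2 * Real.pi) • g 0 ^ 2‖ₑ := by
        rw [enorm_smul, enorm_pow, Real.enorm_eq_ofReal (by positivity)]
    _ ≤ _ := by
        rw [← h]
        refine (enorm_integral_le_lintegral_enorm _).trans (le_of_eq ?_)
        simp only [enorm_pow]

/-- The weight is the hyperbolic density `4 / (1 - t²)²` times `(1 - t²)^k`, the disc counterpart of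
`η^k`; the factor `t` is the polar Jacobian. -/
theorem integral_radial_weight {k ρ : ℝ} (hk : 1 < k) (hρ0 : 0 ≤ ρ) (hρ : ρ < 1) :
    ∫ t in (0 : ℝ)..ρ, t * (4 * (1 - t ^ 2) ^ (k - 2)) =
      2 / (k - 1) * (1 - (1 - ρ ^ 2) ^ (k - 1)) := by
  have hk1 : k - 1 ≠ 0 := by linarith
  have hpos : ∀ t ∈ uIcc 0 ρ, 0 < 1 - t ^ 2 := by
    intro t ht
    rw [uIcc_of_le hρ0] at ht
    nlinarith [ht.1, ht.2]
  have hderiv : ∀ t ∈ uIcc 0 ρ, HasDerivAt (fun t : ℝ => -(2 / (k - 1)) * (1 - t ^ 2) ^ (k - 1))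
      (t * (4 * (1 - t ^ 2) ^ (k - 2))) t := by
    intro t ht
    have h1 : HasDerivAt (fun t : ℝ => 1 - t ^ 2) (-(2 * t)) t := by
      simpa using (hasDerivAt_pow 2 t).const_sub 1
    refine ((h1.rpow_const (p := k - 1) (Or.inl (hpos t ht).ne')).const_mul
      (-(2 / (k - 1)))).congr_deriv ?_
    rw [show k - 1 - 1 = k - 2 by ring]
    field_simp
    ring
  rw [intervalIntegral.integral_eq_sub_of_hasDerivAt hderiv]
  · simp
    ring
  · refine ContinuousOn.intervalIntegrable fun t ht => ContinuousAt.continuousWithinAt ?_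
    have : ContinuousAt (fun t : ℝ => (1 - t ^ 2) ^ (k - 2)) t :=
      ContinuousAt.rpow_const (by fun_prop) (Or.inl (hpos t ht).ne')
    fun_prop

/-- The sub-mean-value inequality on the disc, for the square of the absolute value of a
holomorphic function and the radial weight `4 (1 - |z|²)^(k - 2)`. -/
theorem enorm_sq_mul_le_lintegral_disc {g : ℂ → ℂ} {k ρ : ℝ} (hk : 1 < k) (hρ0 : 0 ≤ ρ)
    (hρ : ρ < 1) (hg : DifferentiableOn ℂ g (Metric.ball 0 1)) :
    ENNReal.ofReal (4 * Real.pi / (k - 1) * (1 - (1 - ρ ^ 2) ^ (k - 1))) * ‖g 0‖ₑ ^ 2 ≤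
      ∫⁻ z in Metric.ball 0 ρ, ‖g z‖ₑ ^ 2 * ENNReal.ofReal (4 * (1 - ‖z‖ ^ 2) ^ (k - 2)) := by
  classical
  set G : ℂ → ENNReal := fun z => ‖g z‖ₑ ^ 2 * ENNReal.ofReal (4 * (1 - ‖z‖ ^ 2) ^ (k - 2))
  have hw : ∀ z ∈ Metric.ball (0 : ℂ) 1, 0 < 1 - ‖z‖ ^ 2 := by
    intro z hz
    rw [mem_ball_zero_iff] at hz
    nlinarith [norm_nonneg z]
  have hsub : Metric.ball (0 : ℂ) ρ ⊆ Metric.ball 0 1 := Metric.ball_subset_ball hρ.le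
  have hGc : ContinuousOn G (Metric.ball 0 ρ) := by
    have h1 : ContinuousOn (fun z : ℂ => 4 * (1 - ‖z‖ ^ 2) ^ (k - 2)) (Metric.ball 0 ρ) :=
      continuousOn_const.mul (ContinuousOn.rpow_const (by fun_prop)
        fun z hz => Or.inl (hw z (hsub hz)).ne')
    have h2 : ContinuousOn (fun z => ‖g z‖ ^ 2 * (4 * (1 - ‖z‖ ^ 2) ^ (k - 2)))
        (Metric.ball 0 ρ) := ((hg.continuousOn.mono hsub).norm.pow 2).mul h1
    refine (ENNReal.continuous_ofReal.comp_continuousOn h2).congr fun z _ => ?_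
    simp only [G, Function.comp_apply]
    rw [ENNReal.ofReal_mul (p := ‖g z‖ ^ 2) (by positivity), ENNReal.ofReal_pow (norm_nonneg _),
      ofReal_norm]
  -- Outside the unit disc `g` is arbitrary; extension by zero gives the global measurability that
  -- Fubini needs.
  set P : ℂ → ENNReal := (Metric.ball (0 : ℂ) ρ).piecewise G 0
  have hP : Measurable P := hGc.measurable_piecewise continuousOn_const measurableSet_ball
  have hPG : ∫⁻ z in Metric.ball 0 ρ, G z = ∫⁻ z, P z := by
    rw [← lintegral_indicator measurableSet_ball]
    simp only [P, piecewise_eq_indicator]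
  have hint : ENNReal.ofReal (2 / (k - 1) * (1 - (1 - ρ ^ 2) ^ (k - 1))) =
      ∫⁻ t in Ioo 0 ρ, ENNReal.ofReal (t * (4 * (1 - t ^ 2) ^ (k - 2))) := by
    rw [← integral_radial_weight hk hρ0 hρ, intervalIntegral.integral_of_le hρ0,
      integral_Ioc_eq_integral_Ioo, ofReal_integral_eq_lintegral_ofReal]
    · refine (ContinuousOn.integrableOn_Icc fun t ht => ContinuousAt.continuousWithinAt ?_).mono_set
        Ioo_subset_Icc_self
      have : ContinuousAt (fun t : ℝ => (1 - t ^ 2) ^ (k - 2)) t :=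
        ContinuousAt.rpow_const (by fun_prop) (Or.inl (by nlinarith [ht.1, ht.2]))
      fun_prop
    · filter_upwards [self_mem_ae_restrict measurableSet_Ioo] with t ht
      have : 0 ≤ 1 - t ^ 2 := by nlinarith [ht.1, ht.2]
      have := ht.1.le
      simp only [Pi.zero_apply]
      positivity
  rw [hPG, ← Complex.lintegral_comp_polarCoord_symm, polarCoord_target,
    Measure.volume_eq_prod, setLIntegral_prod]
  swap
  · have : (⇑Complex.polarCoord.symm : ℝ × ℝ → ℂ) =
        fun p => p.1 * (Real.cos p.2 + Real.sin p.2 * Complex.I) := by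
      ext p; exact Complex.polarCoord_symm_apply p
    have hm : Measurable Complex.polarCoord.symm := by
      rw [this]
      fun_prop
    exact (measurable_fst.ennreal_ofReal.smul (hP.comp hm)).aemeasurable
  calc ENNReal.ofReal (4 * Real.pi / (k - 1) * (1 - (1 - ρ ^ 2) ^ (k - 1))) * ‖g 0‖ₑ ^ 2
      = ∫⁻ t in Ioo 0 ρ, ENNReal.ofReal (t * (4 * (1 - t ^ 2) ^ (k - 2))) *
          (ENNReal.ofReal (2 * Real.pi) * ‖g 0‖ₑ ^ 2) := by
        rw [lintegral_mul_const' _ _ (by finiteness), ← hint, ← mul_assoc,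
          ← ENNReal.ofReal_mul' (by positivity)]
        congr 2
        ring
    _ ≤ ∫⁻ t in Ioo 0 ρ, ∫⁻ θ in Ioo (-Real.pi) Real.pi,
          ENNReal.ofReal t • P (Complex.polarCoord.symm (t, θ)) := by
        refine setLIntegral_mono' measurableSet_Ioo fun t ht => ?_
        have h1 : ∀ θ : ℝ, ENNReal.ofReal t • P (Complex.polarCoord.symm (t, θ)) =
            ENNReal.ofReal (t * (4 * (1 - t ^ 2) ^ (k - 2))) * ‖g (circleMap 0 t θ)‖ₑ ^ 2 := by
          intro θ
          have h2 : Complex.polarCoord.symm (t, θ) = circleMap 0 t θ := by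
            rw [Complex.polarCoord_symm_apply, circleMap, zero_add, Complex.exp_mul_I]
            push_cast
            rfl
          have h3 : ‖circleMap 0 t θ‖ = t := by
            rw [norm_circleMap_zero, abs_of_pos ht.1]
          rw [h2]
          simp only [P]
          rw [piecewise_eq_of_mem _ _ _ (by rw [mem_ball_zero_iff, h3]; exact ht.2)]
          simp only [G, h3, smul_eq_mul]
          rw [ENNReal.ofReal_mul ht.1.le]
          ring
        simp_rw [h1]
        rw [lintegral_const_mul' _ _ ENNReal.ofReal_ne_top]
        gcongr
        exact two_pi_mul_enorm_sq_le_lintegral_circle ht.1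
          (hg.mono (Metric.closedBall_subset_ball (ht.2.trans hρ)))
    _ ≤ _ := lintegral_mono_set Ioo_subset_Ioi_self

/-! ### Transfer to hyperbolic discs by the Cayley transform. -/

theorem lintegral_upperHalfPlane {h : ℍ → ENNReal} (hh : Measurable h) :
    ∫⁻ τ, h τ = ∫⁻ z in {z : ℂ | 0 < z.im},
      ENNReal.ofReal (1 / z.im ^ 2) * h (UpperHalfPlane.ofComplex z) := by
  have hmp : MeasurePreserving UpperHalfPlane.coe (volume.comap UpperHalfPlane.coe)
      (volume.restrict (range UpperHalfPlane.coe)) :=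
    ⟨UpperHalfPlane.measurable_coe, UpperHalfPlane.measurableEmbedding_coe.map_comap _⟩
  have hrange : {z : ℂ | 0 < z.im} = range UpperHalfPlane.coe := UpperHalfPlane.range_coe.symm
  rw [UpperHalfPlane.volume_def, lintegral_withDensity_eq_lintegral_mul _ _ hh,
    hrange, ← hmp.lintegral_comp_emb UpperHalfPlane.measurableEmbedding_coe]
  · refine lintegral_congr fun τ => ?_
    simp only [Pi.mul_apply, UpperHalfPlane.ofComplex_apply, UpperHalfPlane.coe_im]
    congr 1
    rw [ENNReal.ofReal, ENNReal.coe_inj]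
    ext
    have := τ.im_pos
    rw [Real.coe_toNNReal _ (by positivity)]
    simp
  · have hc : Continuous fun τ : ℍ => (1 / NNReal.mk τ.im τ.im_pos.le) ^ 2 :=
      have hi : Continuous fun τ : ℍ => NNReal.mk τ.im τ.im_pos.le :=
        UpperHalfPlane.continuous_im.subtype_mk _
      .pow (.div₀ continuous_const hi fun τ => NNReal.ne_iff.mp τ.im_ne_zero) _
    exact hc.measurable.coe_nnreal_ennreal

/-- The inverse Cayley transform, from the unit disc to `ℍ`, that maps `0` to `τ`. -/
noncomputable def invCayley (τ : ℍ) (z : ℂ) : ℂ :=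
  τ.re + Complex.I * τ.im * ((1 + z) / (1 - z))

theorem invCayley_zero (τ : ℍ) : invCayley τ 0 = τ := by
  rw [invCayley, ← UpperHalfPlane.re_add_im τ]
  simp [mul_comm]

theorem one_sub_ne_zero_of_mem_ball {z : ℂ} (hz : z ∈ Metric.ball (0 : ℂ) 1) : 1 - z ≠ 0 := by
  rw [mem_ball_zero_iff] at hz
  intro h
  rw [← sub_eq_zero.1 h, norm_one] at hz
  exact lt_irrefl _ hz

theorem invCayley_im (τ : ℍ) (z : ℂ) :
    (invCayley τ z).im = τ.im * ((1 - ‖z‖ ^ 2) / ‖1 - z‖ ^ 2) := by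
  have h : ((1 + z) / (1 - z)).re = (1 - ‖z‖ ^ 2) / ‖1 - z‖ ^ 2 := by
    rw [Complex.div_re, ← Complex.normSq_eq_norm_sq, ← Complex.normSq_eq_norm_sq, ← add_div]
    congr 1
    simp only [Complex.add_re, Complex.sub_re, Complex.add_im, Complex.sub_im, Complex.one_re,
      Complex.one_im, Complex.normSq_apply]
    ring
  rw [← h]
  simp [invCayley, mul_assoc]

theorem invCayley_im_pos (τ : ℍ) {z : ℂ} (hz : z ∈ Metric.ball (0 : ℂ) 1) :
    0 < (invCayley τ z).im := by
  rw [invCayley_im]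
  have h1 : 0 < ‖1 - z‖ := norm_pos_iff.2 (one_sub_ne_zero_of_mem_ball hz)
  have h2 : 0 < 1 - ‖z‖ ^ 2 := by
    rw [mem_ball_zero_iff] at hz
    nlinarith [norm_nonneg z]
  have := τ.im_pos
  positivity

theorem hasDerivAt_invCayley (τ : ℍ) {z : ℂ} (hz : z ∈ Metric.ball (0 : ℂ) 1) :
    HasDerivAt (invCayley τ) (2 * Complex.I * τ.im / (1 - z) ^ 2) z := by
  have h := one_sub_ne_zero_of_mem_ball hz
  refine (((((hasDerivAt_id z).const_add 1).div ((hasDerivAt_id z).const_sub 1) h).const_mul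
    (Complex.I * τ.im)).const_add (τ.re : ℂ)).congr_deriv ?_
  simp only [id]
  field_simp
  ring

theorem injOn_invCayley (τ : ℍ) : InjOn (invCayley τ) (Metric.ball 0 1) := by
  intro z hz w hw h
  have hz' := one_sub_ne_zero_of_mem_ball hz
  have hw' := one_sub_ne_zero_of_mem_ball hw
  have hI : Complex.I * (τ.im : ℂ) ≠ 0 :=
    mul_ne_zero Complex.I_ne_zero (Complex.ofReal_ne_zero.2 τ.im_ne_zero)
  have h1 := mul_left_cancel₀ hI (add_left_cancel h)
  rw [div_eq_div_iff hz' hw'] at h1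
  linear_combination h1 / 2

/-- For `w = invCayley τ z` one has `(w - τ) / (w - conj τ) = z`. Hyperbolic radius `R` about `τ`
thus becomes Euclidean radius `tanh (R / 2)`. -/
theorem tanh_half_dist_invCayley (τ : ℍ) {z : ℂ} (hz : z ∈ Metric.ball (0 : ℂ) 1) :
    Real.tanh (dist (UpperHalfPlane.ofComplex (invCayley τ z)) τ / 2) = ‖z‖ := by
  have h := one_sub_ne_zero_of_mem_ball hz
  have hy : (τ.im : ℂ) ≠ 0 := Complex.ofReal_ne_zero.2 τ.im_ne_zero
  have hτ : (τ : ℂ) = τ.re + τ.im * Complex.I := (UpperHalfPlane.re_add_im τ).symm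
  rw [UpperHalfPlane.tanh_half_dist, UpperHalfPlane.ofComplex_apply_of_im_pos
    (invCayley_im_pos τ hz), dist_eq_norm, dist_eq_norm, ← norm_div]
  congr 1
  rw [hτ]
  simp only [map_add, map_mul, Complex.conj_ofReal, Complex.conj_I, invCayley]
  have h1 : (τ.re : ℂ) + Complex.I * τ.im * ((1 + z) / (1 - z)) -
      (τ.re + τ.im * Complex.I) = Complex.I * τ.im * (2 / (1 - z)) * z := by
    field_simp
    ring
  have h2 : (τ.re : ℂ) + Complex.I * τ.im * ((1 + z) / (1 - z)) -
      (τ.re + τ.im * -Complex.I) = Complex.I * τ.im * (2 / (1 - z)) := by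
    field_simp
    ring
  rw [h1, h2, mul_div_cancel_left₀]
  exact mul_ne_zero (mul_ne_zero Complex.I_ne_zero hy) (div_ne_zero two_ne_zero h)

theorem abs_det_restrictScalars_toSpanSingleton (a : ℂ) :
    |((ContinuousLinearMap.toSpanSingleton ℂ a).restrictScalars ℝ).det| = ‖a‖ ^ 2 := by
  simp [ContinuousLinearMap.det, LinearMap.det_restrictScalars,
    Algebra.norm_complex_eq, Complex.normSq_eq_norm_sq]

/-- The sub-mean-value inequality on a hyperbolic disc of radius `R`, for the Petersson norm of a
holomorphic function. -/
theorem petersson_le_lintegral_ball {f : ℍ → ℂ} (hf : MDifferentiable 𝓘(ℂ) 𝓘(ℂ) f) {k : ℝ}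
    (hk : 1 < k) {R : ℝ} (hR : 0 ≤ R) (τ : ℍ) :
    ENNReal.ofReal (4 * Real.pi / (k - 1) * (1 - (1 - Real.tanh (R / 2) ^ 2) ^ (k - 1))) *
        ENNReal.ofReal (‖f τ‖ ^ 2 * τ.im ^ k) ≤
      ∫⁻ w in Metric.ball τ R, ENNReal.ofReal (‖f w‖ ^ 2 * w.im ^ k) := by
  set ρ := Real.tanh (R / 2)
  have hρ0 : 0 ≤ ρ := by
    simp only [ρ, Real.tanh_eq_sinh_div_cosh]
    exact div_nonneg (Real.sinh_nonneg_iff.2 (by positivity)) (Real.cosh_pos _).le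
  have hρ1 : ρ < 1 := Real.tanh_lt_one _
  have hsub : Metric.ball (0 : ℂ) ρ ⊆ Metric.ball 0 1 := Metric.ball_subset_ball hρ1.le
  -- The automorphy factor `(1 - z)^(-k)` is holomorphic since `Re (1 - z) > 0`. By `invCayley_im`,
  -- it makes `‖f‖² Im^k` equal to `τ.im^k ‖g‖² (1 - ‖z‖²)^k`.
  set g : ℂ → ℂ := fun z =>
    f (UpperHalfPlane.ofComplex (invCayley τ z)) * (1 - z) ^ (((-k : ℝ)) : ℂ)
  have hg : DifferentiableOn ℂ g (Metric.ball 0 1) := by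
    refine DifferentiableOn.mul ?_ ?_
    · exact (UpperHalfPlane.mdifferentiable_iff.1 hf).comp
        (fun z hz => (hasDerivAt_invCayley τ hz).differentiableAt.differentiableWithinAt)
        (fun z hz => invCayley_im_pos τ hz)
    · intro z hz
      refine (DifferentiableAt.cpow_const (by fun_prop) ?_).differentiableWithinAt
      left
      rw [mem_ball_zero_iff] at hz
      simpa using (Complex.re_le_norm z).trans_lt hz
  have hg0 : g 0 = f τ := by
    simp [g, invCayley_zero, UpperHalfPlane.ofComplex_apply]
  have hmain := enorm_sq_mul_le_lintegral_disc hk hρ0 hρ1 hg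
  have hfc : Continuous f := hf.continuous
  have hpos : ∀ w : ℍ, 0 < w.im := fun w => w.im_pos
  have hH : Measurable fun w : ℍ => ENNReal.ofReal (‖f w‖ ^ 2 * w.im ^ k) := by
    refine (ENNReal.continuous_ofReal.comp ((hfc.norm.pow 2).mul
      (UpperHalfPlane.continuous_im.rpow_const fun w => Or.inl (hpos w).ne'))).measurable
  have himage : invCayley τ '' Metric.ball 0 ρ ⊆ {z : ℂ | 0 < z.im} := by
    rintro _ ⟨z, hz, rfl⟩
    exact invCayley_im_pos τ (hsub hz)
  rw [← lintegral_indicator measurableSet_ball,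
    lintegral_upperHalfPlane (hH.indicator measurableSet_ball)]
  -- An inequality suffices, so the image of the disc need only lie inside the hyperbolic ball
  -- (`hmem`), not fill it.
  refine le_trans ?_ (lintegral_mono_set himage)
  rw [lintegral_image_eq_lintegral_abs_det_fderiv_mul volume measurableSet_ball
    (fun z hz => ((hasDerivAt_invCayley τ (hsub hz)).hasFDerivAt.restrictScalars
      ℝ).hasFDerivWithinAt) ((injOn_invCayley τ).mono hsub)]
  have hpt : ∀ z ∈ Metric.ball (0 : ℂ) ρ,
      ENNReal.ofReal |((ContinuousLinearMap.toSpanSingleton ℂ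
          (2 * Complex.I * τ.im / (1 - z) ^ 2)).restrictScalars ℝ).det| *
        (ENNReal.ofReal (1 / (invCayley τ z).im ^ 2) *
          (Metric.ball τ R).indicator (fun w : ℍ => ENNReal.ofReal (‖f w‖ ^ 2 * w.im ^ k))
            (UpperHalfPlane.ofComplex (invCayley τ z))) =
      ENNReal.ofReal (τ.im ^ k) *
        (‖g z‖ₑ ^ 2 * ENNReal.ofReal (4 * (1 - ‖z‖ ^ 2) ^ (k - 2))) := by
    intro z hz
    have hz1 := hsub hz
    have hmem : UpperHalfPlane.ofComplex (invCayley τ z) ∈ Metric.ball τ R := by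
      rw [Metric.mem_ball]
      have : Real.tanh (dist (UpperHalfPlane.ofComplex (invCayley τ z)) τ / 2) < ρ := by
        rw [tanh_half_dist_invCayley τ hz1]
        exact mem_ball_zero_iff.1 hz
      have := Real.artanh_lt_artanh (Real.neg_one_lt_tanh _) hρ1 this
      rw [Real.artanh_tanh, Real.artanh_tanh] at this
      linarith
    have him : (UpperHalfPlane.ofComplex (invCayley τ z)).im = (invCayley τ z).im := by
      rw [UpperHalfPlane.ofComplex_apply_of_im_pos (invCayley_im_pos τ hz1)]
      rfl
    rw [indicator_of_mem hmem, him, abs_det_restrictScalars_toSpanSingleton, invCayley_im,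
      ← ofReal_norm, ← ENNReal.ofReal_pow (norm_nonneg _), ← ENNReal.ofReal_mul (by positivity),
      ← ENNReal.ofReal_mul (by positivity), ← ENNReal.ofReal_mul (by positivity),
      ← ENNReal.ofReal_mul (by have := τ.im_pos; positivity)]
    congr 1
    have hy := τ.im_pos
    have hq : 0 < ‖1 - z‖ := norm_pos_iff.2 (one_sub_ne_zero_of_mem_ball hz1)
    have hp : 0 < 1 - ‖z‖ ^ 2 := by
      rw [mem_ball_zero_iff] at hz1
      nlinarith [norm_nonneg z]
    simp only [g, norm_mul, norm_div, norm_pow, Complex.norm_cpow_real, Complex.norm_I,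
      Complex.norm_real, Complex.norm_ofNat, Real.norm_eq_abs, abs_of_pos hy, mul_one]
    generalize ‖f (UpperHalfPlane.ofComplex (invCayley τ z))‖ = A
    generalize ‖1 - z‖ = q at *
    generalize 1 - ‖z‖ ^ 2 = p at *
    generalize τ.im = y at *
    rw [Real.mul_rpow hy.le (by positivity), Real.div_rpow hp.le (by positivity),
      Real.rpow_sub hp, Real.rpow_two, Real.rpow_neg hq.le, ← Real.rpow_natCast q 2,
      ← Real.rpow_mul hq.le, mul_comm ((2 : ℕ) : ℝ) k, Real.rpow_mul hq.le, Real.rpow_natCast,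
      Real.rpow_natCast]
    have := Real.rpow_pos_of_pos hq k
    field_simp
    ring
  rw [setLIntegral_congr_fun measurableSet_ball hpt, lintegral_const_mul' _ _ (by finiteness)]
  rw [mul_comm (‖f τ‖ ^ 2), ENNReal.ofReal_mul (Real.rpow_nonneg (hpos τ).le _),
    ENNReal.ofReal_pow (norm_nonneg _), ofReal_norm, ← hg0, mul_left_comm]
  gcongr

/-! ### From an embedded disc to the fundamental domain. -/

/-- A subset of a `G`-space that is disjoint from its translates has at most the measure of a set
whose translates cover the space; a version for the integral of an invariant function. -/
theorem setLIntegral_le_of_pairwise_disjoint_smul {G α : Type*} [Group G] [Countable G]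
    [MulAction G α] [MeasurableSpace α] [MeasurableConstSMul G α] {μ : Measure α}
    [SMulInvariantMeasure G α μ] {h : α → ENNReal} (hinv : ∀ (g : G) x, h (g • x) = h x)
    {F B : Set α} (hF : MeasurableSet F) (hB : MeasurableSet B)
    (hcov : ∀ x, ∃ g : G, g • x ∈ F)
    (hdisj : Pairwise (Function.onFun Disjoint fun g : G => (fun x => g • x) ⁻¹' B)) :
    ∫⁻ x in B, h x ∂μ ≤ ∫⁻ x in F, h x ∂μ := by
  have hmeas : ∀ g : G, Measurable fun x : α => g • x := fun g => measurable_const_smul g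
  have hB' : ∀ g : G, MeasurableSet ((fun x => g • x) ⁻¹' B) := fun g => hmeas g hB
  calc ∫⁻ x in B, h x ∂μ ≤ ∫⁻ x in ⋃ g : G, B ∩ (fun x => g • x) ⁻¹' F, h x ∂μ := by
        refine lintegral_mono_set fun x hx => ?_
        obtain ⟨g, hg⟩ := hcov x
        exact mem_iUnion.2 ⟨g, hx, hg⟩
    _ ≤ ∑' g : G, ∫⁻ x in B ∩ (fun x => g • x) ⁻¹' F, h x ∂μ := lintegral_iUnion_le _ _
    -- Each piece of `B` is moved into `F` by its `g`, with the same integral by invariance; the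
    -- moved pieces are disjoint.
    _ = ∑' g : G, ∫⁻ x in (fun x => g⁻¹ • x) ⁻¹' B ∩ F, h x ∂μ := by
        refine tsum_congr fun g => ?_
        have hpre : B ∩ (fun x => g • x) ⁻¹' F =
            (fun x => g • x) ⁻¹' ((fun x => g⁻¹ • x) ⁻¹' B ∩ F) := by
          ext x
          simp
        have hchange := (measurePreserving_smul g μ).setLIntegral_comp_preimage_emb
          (measurableEmbedding_const_smul g) h ((fun x => g⁻¹ • x) ⁻¹' B ∩ F)
        simp only [hinv] at hchange
        rw [hpre, hchange]
    _ = ∑' g : G, ∫⁻ x in (fun x => g • x) ⁻¹' B ∩ F, h x ∂μ :=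
        (Equiv.inv G).tsum_eq fun g => ∫⁻ x in (fun x => g • x) ⁻¹' B ∩ F, h x ∂μ
    _ = ∫⁻ x in ⋃ g : G, (fun x => g • x) ⁻¹' B ∩ F, h x ∂μ := by
        rw [lintegral_iUnion (fun g => (hB' g).inter hF)]
        intro g₁ g₂ hne
        exact (hdisj hne).mono inter_subset_left inter_subset_left
    _ ≤ ∫⁻ x in F, h x ∂μ := lintegral_mono_set (iUnion_subset fun g => inter_subset_right)

/-- Only absolute values enter, so neither the branch of the power nor multiplicativity of `χ` plays
a role: `|χ| = 1`, and `Im` scales by `‖cτ + d‖^(-2)`. -/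
theorem norm_sq_mul_im_rpow_smul {Γ : Subgroup SL(2, ℝ)} {k : ℝ} {χ : Γ → Circle} {f : ℍ → ℂ}
    (hf : f ∈ cuspForms Γ k χ) {γ : SL(2, ℝ)} (hγ : γ ∈ Γ) (τ : ℍ) :
    ‖f (γ • τ)‖ ^ 2 * (γ • τ).im ^ k = ‖f τ‖ ^ 2 * τ.im ^ k := by
  have h := congrArg norm (hf.2.1 ⟨γ, hγ⟩ τ)
  have hd : 0 < ‖UpperHalfPlane.denom γ τ‖ := norm_pos_iff.2 (UpperHalfPlane.denom_ne_zero γ τ)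
  have him : (γ • τ).im = τ.im / ‖UpperHalfPlane.denom γ τ‖ ^ 2 := by
    rw [← Complex.normSq_eq_norm_sq]
    exact (UpperHalfPlane.im_smul_eq_div_normSq (γ : GL (Fin 2) ℝ) τ).trans (by simp)
  rw [slash, norm_mul, norm_mul, Circle.norm_coe, one_mul, ← Complex.ofReal_neg,
    Complex.norm_cpow_real] at h
  rw [him, ← h, Real.div_rpow τ.im_pos.le (by positivity), Real.rpow_neg hd.le, mul_pow,
    ← Real.rpow_natCast _ 2, ← Real.rpow_natCast _ 2, ← Real.rpow_natCast _ 2,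
    ← Real.rpow_mul hd.le, mul_comm ((2 : ℕ) : ℝ) k, Real.rpow_mul hd.le, Real.rpow_natCast,
    Real.rpow_natCast, Real.rpow_natCast]
  have := Real.rpow_pos_of_pos hd k
  field_simp

/-- Two points of the ball are less than `injRadius Γ F` apart, so only `± 1` can carry one to the
other. -/
theorem lintegral_ball_le_lintegral_fundDomain {Γ : Subgroup SL(2, ℝ)} (hΓ : IsFuchsian Γ)
    {F : Set ℍ} (hF : IsFundDomain Γ F) {k : ℝ} {χ : Γ → Circle} {f : ℍ → ℂ}
    (hf : f ∈ cuspForms Γ k χ) (τ : ℍ) :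
    ∫⁻ w in Metric.ball τ (injRadius Γ F / 2), ENNReal.ofReal (‖f w‖ ^ 2 * w.im ^ k) ≤
      ∫⁻ w in F, ENNReal.ofReal (‖f w‖ ^ 2 * w.im ^ k) := by
  have : DiscreteTopology Γ := hΓ
  have : SecondCountableTopology (Matrix (Fin 2) (Fin 2) ℝ) :=
    inferInstanceAs (SecondCountableTopology (Fin 2 → Fin 2 → ℝ))
  have : SecondCountableTopology SL(2, ℝ) :=
    Matrix.SpecialLinearGroup.isClosedEmbedding_val.isEmbedding.secondCountableTopology
  have : Countable Γ := countable_of_Lindelof_of_discrete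
  -- If `-1 ∈ Γ`, the elements `γ` and `-γ` give the same translate; in the group of induced
  -- permutations distinct elements give disjoint ones.
  let G := (MulAction.toPermHom Γ ℍ).range
  have : Countable G := (MulAction.toPermHom Γ ℍ).rangeRestrict_surjective.countable
  have hG : ∀ g : G, ∃ γ : SL(2, ℝ), γ ∈ Γ ∧ ∀ x : ℍ, g • x = γ • x := by
    rintro ⟨_, ⟨γ, hγ⟩, rfl⟩
    exact ⟨γ, hγ, fun x => rfl⟩
  have hG' : ∀ γ ∈ Γ, ∃ g : G, ∀ x : ℍ, g • x = γ • x := fun γ hγ =>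
    ⟨⟨_, ⟨γ, hγ⟩, rfl⟩, fun x => rfl⟩
  have : MeasurableConstSMul G ℍ := by
    refine ⟨fun g => ?_⟩
    obtain ⟨γ, -, h⟩ := hG g
    simp only [funext h]
    exact (continuous_const_smul γ).measurable
  have : SMulInvariantMeasure G ℍ volume := by
    refine ⟨fun g s hs => ?_⟩
    obtain ⟨γ, -, h⟩ := hG g
    simp only [h]
    exact measure_preimage_smul volume (γ : GL (Fin 2) ℝ) s
  refine setLIntegral_le_of_pairwise_disjoint_smul (G := G) (fun g x => ?_)
    hF.isClosed.measurableSet measurableSet_ball (fun x => ?_) fun g₁ g₂ hne => ?_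
  · obtain ⟨γ, hγ, h⟩ := hG g
    rw [h, norm_sq_mul_im_rpow_smul hf hγ]
  · obtain ⟨γ, hγ, hx⟩ := hF.covers x
    obtain ⟨g, hg⟩ := hG' γ hγ
    exact ⟨g, by rwa [hg]⟩
  · refine Set.disjoint_left.2 fun x hx₁ hx₂ => hne ?_
    obtain ⟨γ₁, hγ₁, h₁⟩ := hG g₁
    obtain ⟨γ₂, hγ₂, h₂⟩ := hG g₂
    simp only [mem_preimage, h₁, h₂, Metric.mem_ball] at hx₁ hx₂
    have hlt : dist (γ₁ • x) ((γ₂ * γ₁⁻¹) • γ₁ • x) < injRadius Γ F := by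
      rw [smul_smul, inv_mul_cancel_right]
      linarith [dist_triangle_right (γ₁ • x) (γ₂ • x) τ]
    have hcase : γ₂ * γ₁⁻¹ = 1 ∨ γ₂ * γ₁⁻¹ = -1 := by
      by_contra! H
      exact hlt.not_ge (injRadius_le_dist_smul hF.covers _
        (Γ.mul_mem hγ₂ (Γ.inv_mem hγ₁)) H.1 H.2)
    have hact : ∀ y : ℍ, γ₂ • y = γ₁ • y := by
      intro y
      have : γ₂ • y = (γ₂ * γ₁⁻¹) • γ₁ • y := by rw [smul_smul, inv_mul_cancel_right]
      rcases hcase with h | h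
      · rw [this, h, one_smul]
      · rw [this, h, neg_one_smul_upperHalfPlane]
    ext1
    ext1 y
    exact (h₁ y).trans ((hact y).symm.trans (h₂ y).symm)

/-- `‖f(τ)‖² η^k` is at most `(k - 1) / (4π (1 - cosh^(-2(k - 1))(r/4)))` times the square of the
Petersson norm of the cusp form `f`, where `r` is the injectivity radius. -/
theorem petersson_le_lintegral_fundDomain {Γ : Subgroup SL(2, ℝ)} (hΓ : IsFuchsian Γ)
    {F : Set ℍ} (hF : IsFundDomain Γ F) (hr : 0 ≤ injRadius Γ F) {k : ℝ} (hk : 1 < k)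
    {χ : Γ → Circle} {f : ℍ → ℂ} (hf : f ∈ cuspForms Γ k χ) (τ : ℍ) :
    ENNReal.ofReal (4 * Real.pi / (k - 1) *
        (1 - (1 - Real.tanh (injRadius Γ F / 4) ^ 2) ^ (k - 1)) * (‖f τ‖ ^ 2 * τ.im ^ k)) ≤
      ∫⁻ w in F, ENNReal.ofReal (‖f w‖ ^ 2 * w.im ^ k) := by
  have h := petersson_le_lintegral_ball hf.1 hk (div_nonneg hr zero_le_two) τ
  rw [show injRadius Γ F / 2 / 2 = injRadius Γ F / 4 by ring] at h
  rw [ENNReal.ofReal_mul' (by have := τ.im_pos; positivity)]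
  exact h.trans (lintegral_ball_le_lintegral_fundDomain hΓ hF hf τ)

/-! ### Orthonormal bases and the Bergman kernel on the diagonal. -/

/-- A cusp form of Petersson norm `≠ 0` is square integrable. -/
theorem memLp_of_petersson_self_ne_zero {F : Set ℍ} {k : ℝ} {f : ℍ → ℂ} (hf : Continuous f)
    (h : petersson F k f f ≠ 0) :
    MemLp (fun τ => f τ * ((τ.im ^ (k / 2) : ℝ) : ℂ)) 2 (volume.restrict F) := by
  have hc : Continuous fun τ : ℍ => τ.im ^ (k / 2) :=
    UpperHalfPlane.continuous_im.rpow_const fun w => Or.inl w.im_pos.ne'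
  have hm : Continuous fun τ : ℍ => f τ * ((τ.im ^ (k / 2) : ℝ) : ℂ) :=
    hf.mul (Complex.continuous_ofReal.comp hc)
  rw [memLp_two_iff_integrable_sq_norm hm.aestronglyMeasurable]
  -- The integral of a non-integrable function is `0` by convention, so a nonzero value entails
  -- integrability.
  have hint := (not_imp_comm.1 integral_undef h).norm
  refine hint.congr (Eventually.of_forall fun τ => ?_)
  have hp : 0 ≤ τ.im ^ (k / 2) := Real.rpow_nonneg τ.im_pos.le _
  have hsq : τ.im ^ k = τ.im ^ (k / 2) * τ.im ^ (k / 2) := by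
    rw [← Real.rpow_add τ.im_pos, add_halves]
  simp only [norm_mul, RCLike.norm_conj, Complex.norm_real, hsq, Real.norm_eq_abs, abs_of_nonneg hp]
  ring

theorem petersson_eq_integral_mul (F : Set ℍ) (k : ℝ) (f g : ℍ → ℂ) :
    petersson F k f g = ∫ τ in F, (f τ * ((τ.im ^ (k / 2) : ℝ) : ℂ)) *
      conj (g τ * ((τ.im ^ (k / 2) : ℝ) : ℂ)) := by
  refine integral_congr_ae (Eventually.of_forall fun τ => ?_)
  have hsq : τ.im ^ k = τ.im ^ (k / 2) * τ.im ^ (k / 2) := by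
    rw [← Real.rpow_add τ.im_pos, add_halves]
  simp only [hsq, map_mul, Complex.conj_ofReal, Complex.ofReal_mul]
  ring

/-- Pythagoras. Square integrability of the basis, needed to expand the integral, follows from the
normalization `⟨fⱼ, fⱼ⟩ = 1 ≠ 0`. -/
theorem lintegral_sum_orthonormal {Γ : Subgroup SL(2, ℝ)} {F : Set ℍ} {k : ℝ} {χ : Γ → Circle}
    {d : ℕ} {b : Module.Basis (Fin d) ℂ (cuspForms Γ k χ)} (hb : IsOrthonormalBasis F b)
    (c : Fin d → ℂ) :
    ∫⁻ w in F, ENNReal.ofReal (‖∑ j, c j * (b j : ℍ → ℂ) w‖ ^ 2 * w.im ^ k) =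
      ENNReal.ofReal (∑ j, ‖c j‖ ^ 2) := by
  set u : Fin d → ℍ → ℂ := fun j τ => (b j : ℍ → ℂ) τ * ((τ.im ^ (k / 2) : ℝ) : ℂ)
  have hu : ∀ j, MemLp (u j) 2 (volume.restrict F) := fun j => by
    refine memLp_of_petersson_self_ne_zero (b j).2.1.continuous ?_
    rw [hb j j, if_pos rfl]
    exact one_ne_zero
  have hint : ∀ i j, Integrable (fun τ => u i τ * conj (u j τ)) (volume.restrict F) := fun i j =>
    (hu i).integrable_mul (hu j).star
  have hpt : ∀ w : ℍ, ((‖∑ j, c j * (b j : ℍ → ℂ) w‖ ^ 2 * w.im ^ k : ℝ) : ℂ) =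
      ∑ i, ∑ j, c i * conj (c j) * (u i w * conj (u j w)) := by
    intro w
    have hsq : w.im ^ k = w.im ^ (k / 2) * w.im ^ (k / 2) := by
      rw [← Real.rpow_add w.im_pos, add_halves]
    push_cast
    rw [← Complex.mul_conj', map_sum, Finset.sum_mul_sum, hsq, Finset.sum_mul]
    refine Finset.sum_congr rfl fun i _ => ?_
    rw [Finset.sum_mul]
    refine Finset.sum_congr rfl fun j _ => ?_
    simp only [u, map_mul, Complex.conj_ofReal, Complex.ofReal_mul]
    ring
  have hI : Integrable (fun w : ℍ => ((‖∑ j, c j * (b j : ℍ → ℂ) w‖ ^ 2 * w.im ^ k : ℝ) : ℂ))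
      (volume.restrict F) := by
    simp only [hpt]
    exact integrable_finsetSum _ fun i _ => integrable_finsetSum _ fun j _ =>
      (hint i j).const_mul _
  have hval : ∫ w in F, ((‖∑ j, c j * (b j : ℍ → ℂ) w‖ ^ 2 * w.im ^ k : ℝ) : ℂ) =
      ((∑ j, ‖c j‖ ^ 2 : ℝ) : ℂ) := by
    simp only [hpt]
    rw [integral_finsetSum _ fun i _ => integrable_finsetSum _ fun j _ =>
      (hint i j).const_mul _]
    push_cast
    refine Finset.sum_congr rfl fun i _ => ?_
    rw [integral_finsetSum _ fun j _ => (hint i j).const_mul _]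
    simp only [integral_const_mul, u, ← petersson_eq_integral_mul, hb i]
    simp [Complex.mul_conj']
  rw [integral_complex_ofReal, Complex.ofReal_inj] at hval
  have hI' : Integrable (fun w : ℍ => ‖∑ j, c j * (b j : ℍ → ℂ) w‖ ^ 2 * w.im ^ k)
      (volume.restrict F) := hI.re.congr (.of_forall fun w => Complex.ofReal_re _)
  rw [← ofReal_integral_eq_lintegral_ofReal hI', hval]
  exact Eventually.of_forall fun w => by have := w.im_pos; simp only [Pi.zero_apply]; positivity

theorem petNorm_bergmanKernel_self {Γ : Subgroup SL(2, ℝ)} {k : ℝ} {χ : Γ → Circle} {d : ℕ}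
    (b : Module.Basis (Fin d) ℂ (cuspForms Γ k χ)) (τ : ℍ) :
    petNorm k (bergmanKernel b) τ τ = (∑ j, ‖(b j : ℍ → ℂ) τ‖ ^ 2) * τ.im ^ k := by
  rw [petNorm, bergmanKernel, ← sq, ← Real.rpow_natCast, ← Real.rpow_mul τ.im_pos.le]
  congr 1
  · simp only [Complex.mul_conj']
    norm_cast
    exact abs_of_nonneg (by positivity)
  · congr 1
    push_cast
    ring

/-- The bound for the Bergman kernel on the diagonal that the sub-mean-value inequality gives. -/
theorem mul_petNorm_bergmanKernel_le_one {Γ : Subgroup SL(2, ℝ)} (hΓ : IsFuchsian Γ)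
    {F : Set ℍ} (hF : IsFundDomain Γ F) (hr : 0 ≤ injRadius Γ F) {k : ℝ} (hk : 1 < k)
    {χ : Γ → Circle} {d : ℕ} {b : Module.Basis (Fin d) ℂ (cuspForms Γ k χ)}
    (hb : IsOrthonormalBasis F b) (τ : ℍ) :
    4 * Real.pi / (k - 1) * (1 - (1 - Real.tanh (injRadius Γ F / 4) ^ 2) ^ (k - 1)) *
      petNorm k (bergmanKernel b) τ τ ≤ 1 := by
  set B : ℝ := ∑ j, ‖(b j : ℍ → ℂ) τ‖ ^ 2
  have hB0 : 0 ≤ B := Finset.sum_nonneg fun j _ => by positivity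
  -- This is `B(·, τ)`, the extremal form for evaluation at `τ`. The estimate becomes `C B² τ.im^k ≤
  -- B`, and one factor `B` is cancelled.
  let g : cuspForms Γ k χ := ∑ j, conj ((b j : ℍ → ℂ) τ) • b j
  have hg : ∀ w, (g : ℍ → ℂ) w = ∑ j, conj ((b j : ℍ → ℂ) τ) * (b j : ℍ → ℂ) w := fun w => by
    simp [g, Finset.sum_apply]
  have hgτ : ‖(g : ℍ → ℂ) τ‖ = B := by
    rw [hg]
    simp only [Complex.conj_mul']
    norm_cast
    exact abs_of_nonneg hB0
  have h := petersson_le_lintegral_fundDomain hΓ hF hr hk g.2 τ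
  simp only [hg] at h
  rw [lintegral_sum_orthonormal hb, ← hg, hgτ] at h
  simp only [RCLike.norm_conj] at h
  rw [ENNReal.ofReal_le_ofReal_iff hB0] at h
  rw [petNorm_bergmanKernel_self]
  change _ * (B * _) ≤ 1
  rcases hB0.eq_or_lt with h0 | h0
  · rw [← h0]
    simp
  · refine le_of_mul_le_mul_right ?_ h0
    nlinarith

/-! ### Reduction to the stated form of the bound. -/

theorem le_of_mul_one_sub_sech_rpow_le_one {k r : ℝ} (hk : 5 ≤ k) (hr : 0 < r) {x : ℝ}
    (hx : 4 * Real.pi / (k - 1) * (1 - (1 - Real.tanh (r / 4) ^ 2) ^ (k - 1)) * x ≤ 1) :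
    x ≤ (k - 1) / (2 * Real.pi) + 3 * (k - 1) / (Real.pi * Real.cosh (r / 4) ^ (k - 4)) *
          (1 + 1 / Real.sinh (r / 4) ^ 2) := by
  have hs : 0 < Real.sinh (r / 4) := Real.sinh_pos_iff.2 (by positivity)
  have hcs := Real.cosh_sq (r / 4)
  have ht : 1 - Real.tanh (r / 4) ^ 2 = (Real.cosh (r / 4) ^ 2)⁻¹ := by
    have := Real.cosh_pos (r / 4)
    rw [Real.tanh_eq_sinh_div_cosh]
    field_simp
    linarith
  have hc1 : 1 < Real.cosh (r / 4) := Real.one_lt_cosh.2 (by positivity)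
  rw [ht] at hx
  generalize Real.cosh (r / 4) = c at *
  generalize Real.sinh (r / 4) = s at *
  have hc0 : 0 < c := by linarith
  have hπ := Real.pi_pos
  have hq : 0 < c ^ (k - 4) := Real.rpow_pos_of_pos hc0 _
  have hq1 : 1 ≤ c ^ (k - 4) := Real.one_le_rpow hc1.le (by linarith)
  -- The split `2 (k - 1) = 2 (k - 4) + 6` brings in the power `q = c ^ (k - 4)` of the target.
  have hw : ((c ^ 2)⁻¹) ^ (k - 1) = ((c ^ (k - 4)) ^ 2 * c ^ 6)⁻¹ := by
    rw [Real.inv_rpow (by positivity), ← Real.rpow_natCast c 2, ← Real.rpow_mul hc0.le,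
      ← Real.rpow_natCast _ 2, ← Real.rpow_mul hc0.le, ← Real.rpow_natCast c 6,
      ← Real.rpow_add hc0]
    congr 2
    push_cast
    ring
  rw [hw] at hx
  generalize c ^ (k - 4) = q at *
  have hm : 0 < k - 1 := by linarith
  have hqs : 0 < q * s ^ 2 := by positivity
  -- Since `c² = 1 + s²` and `q ≥ 1`, one has `q s² = q c² - q ≤ q² c⁶ - 1`.
  have hD : q * s ^ 2 ≤ q ^ 2 * c ^ 6 - 1 := by
    have h1 : q * c ^ 2 ≤ q ^ 2 * c ^ 6 := by
      gcongr ?_ * ?_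
      · nlinarith
      · exact pow_le_pow_right₀ hc1.le (by norm_num)
    nlinarith
  generalize q ^ 2 * c ^ 6 = W at *
  have hW : 0 < W - 1 := hqs.trans_le hD
  have hW0 : 0 < W := by linarith
  -- Here `1 / (1 - W⁻¹) = 1 + 1 / (W - 1)`. By `hD` the last factor is at most `1 + 1 / (q s²)`,
  -- well below the `2 + 12 (1 / q + 1 / (q s²))` of `heq`.
  have hx' : x ≤ (k - 1) / (4 * Real.pi) * (1 + 1 / (W - 1)) := by
    have hpos : 0 < 4 * Real.pi / (k - 1) * (1 - W⁻¹) := by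
      have : 0 < 1 - W⁻¹ := by
        rw [sub_pos]
        exact inv_lt_one_of_one_lt₀ (by linarith)
      positivity
    rw [mul_comm, ← le_div_iff₀ hpos] at hx
    refine hx.trans (le_of_eq ?_)
    field_simp
    ring
  have hinv : 1 / (W - 1) ≤ 1 / (q * s ^ 2) := one_div_le_one_div_of_le hqs hD
  have hA : 0 < (k - 1) / (4 * Real.pi) := by positivity
  have hB : 0 < 1 / (q * s ^ 2) := by positivity
  have hC : 0 < 1 / q := by positivity
  have heq : (k - 1) / (2 * Real.pi) + 3 * (k - 1) / (Real.pi * q) * (1 + 1 / s ^ 2) =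
      (k - 1) / (4 * Real.pi) * (2 + 12 * (1 / q + 1 / (q * s ^ 2))) := by
    field_simp
    ring
  rw [heq]
  refine hx'.trans (mul_le_mul_of_nonneg_left ?_ hA.le)
  linarith

end BergmanKernel

end

/-- `Γ` is a cocompact Fuchsian group without elliptic elements, `F` any fundamental domain of it,
and `χ` any map from `Γ` to the unit circle: a unitary character, or, if the weight `k` is not an
integer, a unitary multiplier system. The bound holds whichever orthonormal basis is used to write
the Bergman kernel. -/
theorem proposition3p1 (Γ : Subgroup SL(2, ℝ)) (hΓ : BergmanKernel.IsFuchsian Γ)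
    (hcc : BergmanKernel.IsCocompact Γ) (hell : BergmanKernel.HasNoElliptic Γ)
    (F : Set ℍ) (hF : BergmanKernel.IsFundDomain Γ F)
    (k : ℝ) (hk : 5 ≤ k) (χ : Γ → Circle)
    (d : ℕ) (b : Module.Basis (Fin d) ℂ (BergmanKernel.cuspForms Γ k χ))
    (hb : BergmanKernel.IsOrthonormalBasis F b) (τ : ℍ) :
    BergmanKernel.petNorm k (BergmanKernel.bergmanKernel b) τ τ ≤
      (k - 1) / (2 * Real.pi) +
        3 * (k - 1) / (Real.pi * Real.cosh (BergmanKernel.injRadius Γ F / 4) ^ (k - 4)) *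
          (1 + 1 / Real.sinh (BergmanKernel.injRadius Γ F / 4) ^ 2) := by
  have hr := BergmanKernel.injRadius_pos hΓ hcc hell hF.isConnected.nonempty
  exact BergmanKernel.le_of_mul_one_sub_sech_rpow_le_one hk hr
    (BergmanKernel.mul_petNorm_bergmanKernel_le_one hΓ hF hr.le (by linarith) hb τ)
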